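/- Let $\mathcal{A}$ be a Banach algebra (over $\mathbb{R}$ or $\mathbb{C}$, not necessarily unital) with a two-sided bounded approximate identity, and let $X$ be a Banach $\mathcal{A}$-bimodule; its dual $X^*$ is a Banach $\mathcal{A}$-bimodule via $\langle x, a\cdot\varphi\rangle=\langle x\cdot a,\varphi\rangle$ and $\langle x,\varphi\cdot a\rangle=\langle a\cdot x,\varphi\rangle$. For a Banach $\mathcal{A}$-bimodule $Y$ let $\mathcal{BL}^n(\mathcal{A},Y)$ be the space of bounded $n$-linear maps $\mathcal{A}^n\to Y$ (with $\mathcal{BL}^0(\mathcal{A},Y)=Y$), and let $\delta^n:\mathcal{BL}^n(\mathcal{A},Y)\to\mathcal{BL}^{n+1}(\mathcal{A},Y)$ be the Hochschild coboundary operator $$(\delta^nT)(a_1,\dots,a_{n+1})=a_1\cdot T(a_2,\dots,a_{n+1})+\sum_{k=1}^n(-1)^kT(a_1,\dots,a_ka_{k+1},\dots,a_{n+1})+(-1)^{n+1}T(a_1,\dots,a_n)\cdot a_{n+1}.$$ For $n\ge 1$ the $n$-th approximate Hochschild cohomology is $$\mathcal{H}^n_{app}(\mathcal{A},Y)=\ker\delta^n\big/\,\overline{\operatorname{ran}\delta^{n-1}},$$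 where the closure is taken in the strong topology, i.e. the topology of pointwise norm convergence on $\mathcal{A}^n$. Put $X_1=\{a\cdot x\cdot b: a,b\in\mathcal{A},\ x\in X\}$. Then $X_1$ is a closed linear subspace of $X$, it is a sub-$\mathcal{A}$-bimodule, and it is neo-unital: every $x\in X_1$ can be written as $x=a\cdot y\cdot b$ with $a,b\in\mathcal{A}$ and $y\in X_1$. The annihilator $X_1^\perp=\{\varphi\in X^*:\varphi|_{X_1}=0\}$ is complemented in $X^*$, i.e. it is the range of a bounded linear projection on $X^*$. Moreover, for every $n\ge 1$, the restriction map $X^*\to X_1^*$ induces a linear isomorphism $$\mathcal{H}^n_{app}(\mathcal{A},X^*)\cong\mathcal{H}^n_{app}(\mathcal{A},X_1^*).$$ -/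

import Mathlib

open scoped Topology

noncomputable section

/-- A two-sided bounded approximate identity: a proper filter `l` on `A` (equivalently, a net),
bounded in norm, along which `a * e → a` and `e * a → a` for every `a`. -/
def HasBoundedApproximateIdentity (A : Type*) [NonUnitalNormedRing A] : Prop :=
  ∃ l : Filter A, l.IsApproximateUnit ∧ ∃ C : ℝ, ∀ᶠ e in l, ‖e‖ ≤ C

/-- The structure of an `A`-bimodule on a normed space `X`, with jointly bounded bilinear actions
`lact a x = a · x` and `ract a x = x · a`. When `X` is complete this is a Banach `A`-bimodule. -/
structure BanachBimodule (𝕜 A X : Type*) [RCLike 𝕜] [NonUnitalNormedRing A] [NormedSpace 𝕜 A]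
    [NormedAddCommGroup X] [NormedSpace 𝕜 X] where
  lact : A →L[𝕜] X →L[𝕜] X
  ract : A →L[𝕜] X →L[𝕜] X
  lact_mul : ∀ a b x, lact (a * b) x = lact a (lact b x)
  ract_mul : ∀ a b x, ract (a * b) x = ract b (ract a x)
  lact_ract : ∀ a b x, lact a (ract b x) = ract b (lact a x)

namespace BanachBimodule

section Basic

variable {𝕜 A X : Type*} [RCLike 𝕜] [NonUnitalNormedRing A] [NormedSpace 𝕜 A]
  [NormedAddCommGroup X] [NormedSpace 𝕜 X]

/-- The dual bimodule: `⟨x, a · φ⟩ = ⟨x · a, φ⟩` and `⟨x, φ · a⟩ = ⟨a · x, φ⟩`. -/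
def dual (M : BanachBimodule 𝕜 A X) : BanachBimodule 𝕜 A (StrongDual 𝕜 X) where
  lact := (ContinuousLinearMap.compL 𝕜 X X 𝕜).flip ∘L M.ract
  ract := (ContinuousLinearMap.compL 𝕜 X X 𝕜).flip ∘L M.lact
  lact_mul a b φ := by ext x; simp [M.ract_mul]
  ract_mul a b φ := by ext x; simp [M.lact_mul]
  lact_ract a b φ := by ext x; simp [M.lact_ract]

@[simp]
theorem dual_lact_apply (M : BanachBimodule 𝕜 A X) (a : A) (φ : StrongDual 𝕜 X) (x : X) :
    M.dual.lact a φ x = φ (M.ract a x) := rfl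

@[simp]
theorem dual_ract_apply (M : BanachBimodule 𝕜 A X) (a : A) (φ : StrongDual 𝕜 X) (x : X) :
    M.dual.ract a φ x = φ (M.lact a x) := rfl

/-- Every element is of the form `a · y · b`. -/
def IsNeoUnital (M : BanachBimodule 𝕜 A X) : Prop :=
  ∀ x : X, ∃ (a b : A) (y : X), x = M.ract b (M.lact a y)

/-- The set `{a · x · b : a, b ∈ A, x ∈ X}`. -/
def productSet (M : BanachBimodule 𝕜 A X) : Set X :=
  {y | ∃ (a b : A) (x : X), y = M.ract b (M.lact a x)}

/-- A linear subspace stable under both actions of `A`. -/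
structure SubBimodule (M : BanachBimodule 𝕜 A X) extends Submodule 𝕜 X where
  lact_mem : ∀ (a : A) {x : X}, x ∈ toSubmodule → M.lact a x ∈ toSubmodule
  ract_mem : ∀ (a : A) {x : X}, x ∈ toSubmodule → M.ract a x ∈ toSubmodule

/-- The restriction of a family of operators `A → BL(X)` leaving `Y` invariant to `A → BL(Y)`. -/
def restrictAct (f : A →L[𝕜] X →L[𝕜] X) (Y : Submodule 𝕜 X)
    (h : ∀ (a : A) {x : X}, x ∈ Y → f a x ∈ Y) : A →L[𝕜] Y →L[𝕜] Y :=
  LinearMap.mkContinuous₂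
    (LinearMap.mk₂ 𝕜 (fun (a : A) (y : Y) => (⟨f a y, h a y.2⟩ : Y))
      (fun a b y => by ext; simp) (fun c a y => by ext; simp)
      (fun a y z => by ext; simp) (fun c a y => by ext; simp))
    ‖f‖ (fun a y => f.le_opNorm₂ a (y : X))

@[simp]
theorem coe_restrictAct (f : A →L[𝕜] X →L[𝕜] X) (Y : Submodule 𝕜 X)
    (h : ∀ (a : A) {x : X}, x ∈ Y → f a x ∈ Y) (a : A) (y : Y) :
    (restrictAct f Y h a y : X) = f a y := rfl

/-- The bimodule structure that a sub-bimodule inherits. -/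
def SubBimodule.toBanachBimodule {M : BanachBimodule 𝕜 A X} (Y : M.SubBimodule) :
    BanachBimodule 𝕜 A Y.toSubmodule where
  lact := restrictAct M.lact Y.toSubmodule Y.lact_mem
  ract := restrictAct M.ract Y.toSubmodule Y.ract_mem
  lact_mul a b x := by ext; simp [M.lact_mul]
  ract_mul a b x := by ext; simp [M.ract_mul]
  lact_ract a b x := by ext; simp [M.lact_ract]

/-- The annihilator `Y^⊥ = {φ ∈ X* : φ = 0 on Y}`. -/
def annihilator (Y : Submodule 𝕜 X) : Submodule 𝕜 (StrongDual 𝕜 X) where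
  carrier := {φ | ∀ y ∈ Y, φ y = 0}
  add_mem' hφ hψ y hy := by simp [hφ y hy, hψ y hy]
  zero_mem' y _ := rfl
  smul_mem' c φ hφ y hy := by simp [hφ y hy]

/-- The restriction map `X* → Y*`. -/
def restrictDual (Y : Submodule 𝕜 X) : StrongDual 𝕜 X →L[𝕜] StrongDual 𝕜 Y :=
  (ContinuousLinearMap.compL 𝕜 Y X 𝕜).flip Y.subtypeL

@[simp]
theorem restrictDual_apply (Y : Submodule 𝕜 X) (φ : StrongDual 𝕜 X) (y : Y) :
    restrictDual Y φ y = φ y := rfl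

end Basic

section Cochains

variable {𝕜 A X Y : Type*} [RCLike 𝕜] [NonUnitalNormedRing A] [NormedSpace 𝕜 A]
  [NormedAddCommGroup X] [NormedSpace 𝕜 X] [NormedAddCommGroup Y] [NormedSpace 𝕜 Y]

variable (𝕜 A X) in
/-- The strong topology on `BLⁿ(A, X)`: `T_i → T` iff `‖(T_i - T)(a₁, …, aₙ)‖ → 0` for all
`a₁, …, aₙ`. -/
abbrev strongTopology (n : ℕ) : TopologicalSpace (A [×n]→L[𝕜] X) :=
  TopologicalSpace.induced (fun T => (T : (Fin n → A) → X)) Pi.topologicalSpace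

theorem mem_closure_strongTopology {n : ℕ} (S : Set (A [×n]→L[𝕜] X)) (T : A [×n]→L[𝕜] X) :
    T ∈ closure[strongTopology 𝕜 A X n] S ↔
      (T : (Fin n → A) → X) ∈ closure ((fun T : A [×n]→L[𝕜] X => (T : (Fin n → A) → X)) '' S) :=
  closure_induced

/-- The closure of a subspace of `BLⁿ(A, X)` in the strong topology. -/
def strongClosure {n : ℕ} (S : Submodule 𝕜 (A [×n]→L[𝕜] X)) :
    Submodule 𝕜 (A [×n]→L[𝕜] X) where
  carrier := closure[strongTopology 𝕜 A X n] (S : Set (A [×n]→L[𝕜] X))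
  add_mem' {T U} hT hU := by
    rw [mem_closure_strongTopology] at hT hU ⊢
    refine map_mem_closure₂ (f := fun u v : (Fin n → A) → X => u + v) continuous_add hT hU ?_
    rintro _ ⟨T', hT', rfl⟩ _ ⟨U', hU', rfl⟩
    exact ⟨T' + U', S.add_mem hT' hU', rfl⟩
  zero_mem' := by
    rw [mem_closure_strongTopology]
    exact subset_closure ⟨0, S.zero_mem, rfl⟩
  smul_mem' c T hT := by
    rw [mem_closure_strongTopology] at hT ⊢
    refine map_mem_closure (f := fun u : (Fin n → A) → X => c • u) (continuous_const_smul c) hT ?_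
    rintro _ ⟨T', hT', rfl⟩
    exact ⟨c • T', S.smul_mem c hT', rfl⟩

/-- Bounded bimodule homomorphisms. -/
structure IsBimoduleHom (M : BanachBimodule 𝕜 A X) (N : BanachBimodule 𝕜 A Y) (f : X →L[𝕜] Y) : Prop where
  map_lact : ∀ a x, f (M.lact a x) = N.lact a (f x)
  map_ract : ∀ a x, f (M.ract a x) = N.ract a (f x)

variable (A) in
/-- The map `BLⁿ(A, X) → BLⁿ(A, Y)`, `T ↦ f ∘ T`. -/
def cochainMap (f : X →L[𝕜] Y) (n : ℕ) : (A [×n]→L[𝕜] X) →ₗ[𝕜] (A [×n]→L[𝕜] Y) where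
  toFun T := f.compContinuousMultilinearMap T
  map_add' S T := by ext; simp
  map_smul' c T := by ext; simp

theorem cochainMap_apply (f : X →L[𝕜] Y) (n : ℕ) (T : A [×n]→L[𝕜] X) (a : Fin n → A) :
    cochainMap A f n T a = f (T a) := rfl

end Cochains

section Hochschild

variable {𝕜 A X : Type*} [RCLike 𝕜] [NonUnitalNormedRing A] [NormedSpace 𝕜 A]
  [IsScalarTower 𝕜 A A] [SMulCommClass 𝕜 A A]
  [NormedAddCommGroup X] [NormedSpace 𝕜 X]

variable (𝕜) in
/-- Changing one entry of a tuple changes one entry of the contracted tuple, linearly. -/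
theorem contractNth_update {n : ℕ} (k : Fin n) (a : Fin (n + 1) → A) (i : Fin (n + 1)) :
    ∃ (j : Fin n) (L : A →ₗ[𝕜] A), ∀ x : A,
      k.castSucc.contractNth (· * ·) (Function.update a i x) =
        Function.update (k.castSucc.contractNth (· * ·) a) j (L x) := by
  rcases lt_trichotomy (i : ℕ) (k : ℕ) with h | h | h
  · refine ⟨⟨i, by omega⟩, LinearMap.id, fun x => ?_⟩
    ext l
    simp only [Fin.contractNth, Function.update_apply, Fin.ext_iff, Fin.val_castSucc, Fin.val_succ,
      LinearMap.id_apply]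
    grind
  · refine ⟨k, LinearMap.mulRight 𝕜 (a k.succ), fun x => ?_⟩
    ext l
    simp only [Fin.contractNth, Function.update_apply, Fin.ext_iff, Fin.val_castSucc, Fin.val_succ,
      LinearMap.mulRight_apply]
    grind
  · by_cases h' : (i : ℕ) = k + 1
    · refine ⟨k, LinearMap.mulLeft 𝕜 (a k.castSucc), fun x => ?_⟩
      ext l
      simp only [Fin.contractNth, Function.update_apply, Fin.ext_iff, Fin.val_castSucc,
        Fin.val_succ, LinearMap.mulLeft_apply]
      grind
    · refine ⟨⟨i - 1, by omega⟩, LinearMap.id, fun x => ?_⟩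
      ext l
      simp only [Fin.contractNth, Function.update_apply, Fin.ext_iff, Fin.val_castSucc,
        Fin.val_succ, LinearMap.id_apply]
      grind

/-- For `k = 0, …, n - 1`, the map `(a₀, …, aₙ) ↦ T(a₀, …, a_k a_{k+1}, …, aₙ)`. -/
def contractArg {n : ℕ} (k : Fin n) (T : A [×n]→L[𝕜] X) : A [×(n + 1)]→L[𝕜] X where
  toFun a := T (k.castSucc.contractNth (· * ·) a)
  map_update_add' {inst} a i x y := by
    obtain rfl : inst = instDecidableEqFin (n + 1) := Subsingleton.elim _ _
    obtain ⟨j, L, h⟩ := contractNth_update 𝕜 k a i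
    simp [h]
  map_update_smul' {inst} a i c x := by
    obtain rfl : inst = instDecidableEqFin (n + 1) := Subsingleton.elim _ _
    obtain ⟨j, L, h⟩ := contractNth_update 𝕜 k a i
    simp [h]
  cont := by
    refine T.cont.comp (continuous_pi fun l => ?_)
    simp only [Fin.contractNth]
    split_ifs <;> fun_prop

@[simp]
theorem contractArg_apply {n : ℕ} (k : Fin n) (T : A [×n]→L[𝕜] X) (a : Fin (n + 1) → A) :
    contractArg k T a = T (k.castSucc.contractNth (· * ·) a) := rfl

/-- The value of `δⁿ` on a single cochain. -/
def coboundaryFun (M : BanachBimodule 𝕜 A X) (n : ℕ) (T : A [×n]→L[𝕜] X) :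
    A [×(n + 1)]→L[𝕜] X :=
  ContinuousLinearMap.uncurryLeft
      ((ContinuousLinearMap.compContinuousMultilinearMapL 𝕜 (fun _ : Fin n => A) X X).flip T
        ∘L M.lact)
    + ∑ k : Fin n, (-1 : 𝕜) ^ ((k : ℕ) + 1) • contractArg k T
    + (-1 : 𝕜) ^ (n + 1) •
      ContinuousMultilinearMap.uncurryRight (M.ract.flip.compContinuousMultilinearMap T)

/-- The Hochschild coboundary formula, with arguments numbered from `0`: `Fin.tail a` is
`(a₁, …, aₙ)` and `Fin.init a` is `(a₀, …, aₙ₋₁)`. -/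
theorem coboundaryFun_apply (M : BanachBimodule 𝕜 A X) (n : ℕ) (T : A [×n]→L[𝕜] X)
    (a : Fin (n + 1) → A) :
    M.coboundaryFun n T a = M.lact (a 0) (T (Fin.tail a))
      + ∑ k : Fin n, (-1 : 𝕜) ^ ((k : ℕ) + 1) • T (k.castSucc.contractNth (· * ·) a)
      + (-1 : 𝕜) ^ (n + 1) • M.ract (a (Fin.last n)) (T (Fin.init a)) := by
  simp [coboundaryFun]

/-- The Hochschild coboundary operator `δⁿ : BLⁿ(A, X) → BLⁿ⁺¹(A, X)`. -/
def coboundary (M : BanachBimodule 𝕜 A X) (n : ℕ) :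
    (A [×n]→L[𝕜] X) →ₗ[𝕜] (A [×(n + 1)]→L[𝕜] X) where
  toFun := M.coboundaryFun n
  map_add' S T := by
    ext a
    simp only [coboundaryFun_apply, add_apply, map_add, smul_add,
      Finset.sum_add_distrib]
    abel
  map_smul' c T := by
    ext a
    simp only [coboundaryFun_apply, smul_apply, map_smul, smul_add,
      Finset.smul_sum, RingHom.id_apply, smul_comm c]

theorem coboundary_apply (M : BanachBimodule 𝕜 A X) (n : ℕ) (T : A [×n]→L[𝕜] X)
    (a : Fin (n + 1) → A) :
    M.coboundary n T a = M.lact (a 0) (T (Fin.tail a))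
      + ∑ k : Fin n, (-1 : 𝕜) ^ ((k : ℕ) + 1) • T (k.castSucc.contractNth (· * ·) a)
      + (-1 : 𝕜) ^ (n + 1) • M.ract (a (Fin.last n)) (T (Fin.init a)) :=
  M.coboundaryFun_apply n T a

/-- The `n`-cocycles `Zⁿ(A, X) = ker δⁿ`. -/
def cocycles (M : BanachBimodule 𝕜 A X) (n : ℕ) : Submodule 𝕜 (A [×n]→L[𝕜] X) :=
  LinearMap.ker (M.coboundary n)

/-- The `n`-coboundaries `Bⁿ(A, X) = ran δⁿ⁻¹` (and `0` for `n = 0`). -/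
def coboundaries (M : BanachBimodule 𝕜 A X) : (n : ℕ) → Submodule 𝕜 (A [×n]→L[𝕜] X)
  | 0 => ⊥
  | n + 1 => LinearMap.range (M.coboundary n)

/-- The approximate Hochschild cohomology `Zⁿ(A, X) / closure of Bⁿ(A, X)`. -/
abbrev ApproxCohomology (M : BanachBimodule 𝕜 A X) (n : ℕ) : Type _ :=
  M.cocycles n ⧸ (strongClosure (M.coboundaries n)).submoduleOf (M.cocycles n)

variable {Y : Type*} [NormedAddCommGroup Y] [NormedSpace 𝕜 Y]
  {M : BanachBimodule 𝕜 A X} {N : BanachBimodule 𝕜 A Y} {f : X →L[𝕜] Y}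

theorem IsBimoduleHom.coboundary_cochainMap (hf : IsBimoduleHom M N f) (n : ℕ)
    (T : A [×n]→L[𝕜] X) :
    N.coboundary n (cochainMap A f n T) = cochainMap A f (n + 1) (M.coboundary n T) := by
  ext a
  simp [coboundary_apply, cochainMap_apply, hf.map_lact, hf.map_ract]

theorem IsBimoduleHom.cochainMap_mem_cocycles (hf : IsBimoduleHom M N f) (n : ℕ) :
    ∀ T ∈ M.cocycles n, cochainMap A f n T ∈ N.cocycles n := by
  intro T hT
  rw [cocycles, LinearMap.mem_ker] at hT ⊢
  rw [hf.coboundary_cochainMap, hT, map_zero]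

theorem IsBimoduleHom.cochainMap_mem_coboundaries (hf : IsBimoduleHom M N f) (n : ℕ)
    (T : A [×n]→L[𝕜] X) (hT : T ∈ M.coboundaries n) :
    cochainMap A f n T ∈ N.coboundaries n := by
  cases n with
  | zero =>
    obtain rfl : T = 0 := hT
    rw [map_zero]
    exact Submodule.zero_mem _
  | succ n =>
    obtain ⟨S, rfl⟩ := hT
    exact ⟨cochainMap A f n S, hf.coboundary_cochainMap n S⟩

theorem IsBimoduleHom.cochainMap_mem_strongClosure (hf : IsBimoduleHom M N f) (n : ℕ)
    (T : A [×n]→L[𝕜] X) (hT : T ∈ strongClosure (M.coboundaries n)) :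
    cochainMap A f n T ∈ strongClosure (N.coboundaries n) := by
  have hT' := (mem_closure_strongTopology _ _).1 hT
  refine (mem_closure_strongTopology _ _).2 ?_
  have hc : Continuous fun (u : (Fin n → A) → X) (a : Fin n → A) => f (u a) := by fun_prop
  refine map_mem_closure (f := fun (u : (Fin n → A) → X) (a : Fin n → A) => f (u a)) hc hT' ?_
  rintro _ ⟨U, hU, rfl⟩
  exact ⟨cochainMap A f n U, hf.cochainMap_mem_coboundaries n U hU, rfl⟩

/-- The map on approximate cohomology induced by a bounded bimodule homomorphism:
`[T] ↦ [f ∘ T]`. -/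
def ApproxCohomology.map (hf : IsBimoduleHom M N f) (n : ℕ) :
    M.ApproxCohomology n →ₗ[𝕜] N.ApproxCohomology n :=
  Submodule.mapQ _ _
    ((cochainMap A f n).restrict (hf.cochainMap_mem_cocycles n))
    (fun T hT => hf.cochainMap_mem_strongClosure n T hT)

end Hochschild

section RestrictHom

variable {𝕜 A X : Type*} [RCLike 𝕜] [NonUnitalNormedRing A] [NormedSpace 𝕜 A]
  [NormedAddCommGroup X] [NormedSpace 𝕜 X]

/-- Restriction `X* → Y*` to a sub-bimodule `Y` is a bimodule homomorphism. -/
theorem SubBimodule.isBimoduleHom_restrictDual {M : BanachBimodule 𝕜 A X} (Y : M.SubBimodule) :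
    IsBimoduleHom M.dual Y.toBanachBimodule.dual (restrictDual Y.toSubmodule) where
  map_lact _ _ := rfl
  map_ract _ _ := rfl

end RestrictHom

end BanachBimodule

end

/-! Along a bounded approximate identity `e`, let `X₁` be the set of `x` with `e · x → x` and `x · e
→ x`. This is visibly a closed sub-bimodule, and Cohen factorization on each side identifies it with
the set of products `a · y · b`, with `y` again in it. This yields linearity, closedness and
neo-unitality together.

On `X*`, an ultrafilter refining the approximate identity gives bounded operators `Pφ = lim φ · e`
and `Rφ = lim e · φ` (weak-* limits), both bimodule homomorphisms. The composite `E = P ∘ R`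
satisfies `⟨x, Eφ⟩ = lim_e lim_f φ(e · x · f)`, so it kills `X₁^⊥` and does not change `φ` on `X₁`.
Hence `1 - E` is a projection onto `X₁^⊥`, and `E` applied to any Hahn–Banach extension is a bounded
bimodule section `s` of the restriction `r : X* → X₁*`.

Now `r ∘ s = 1` and `s ∘ r = E`, so it remains to see that `E` acts trivially on cohomology in
degree `n ≥ 1`. The cocycles `T - PT` and `T - RT` take values with zero products on one side;
averaging `e` into one argument exhibits such a cocycle as a genuine coboundary
(`mem_coboundaries_of_ract_eq_zero`, `mem_coboundaries_of_lact_eq_zero`). The strong closure matters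
only in that composition with `s` and `r` preserves it. -/

open Filter

/-! ### Cohen factorization -/

section CohenFactorization

variable {𝕜 A X : Type*} [RCLike 𝕜] [NormedAddCommGroup A] [NormedSpace 𝕜 A]
  [NormedAddCommGroup X] [NormedSpace 𝕜 X]

theorem tendsto_clm_apply {ι : Type*} {l : Filter ι} {F : ι → X →L[𝕜] X} {f : ι → X}
    {T : X →L[𝕜] X} {x : X} (hF : Tendsto F l (𝓝 T)) (hf : Tendsto f l (𝓝 x)) :
    Tendsto (fun i => F i (f i)) l (𝓝 (T x)) :=
  (isBoundedBilinearMap_apply.continuous.tendsto (T, x)).comp (hF.prodMk_nhds hf)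

variable [CompleteSpace X]

/-- For small `c`, the operators `(1 - c) + c L` with `‖L‖ ≤ C` are invertible, with uniformly
bounded inverses. -/
theorem exists_inverse_convexCombination_one {C c : ℝ} (hc0 : 0 < c) (hc1 : c < 1)
    (hcC : c * C ≤ (1 - c) / 2) (L : X →L[𝕜] X) (hL : ‖L‖ ≤ C) :
    ∃ V : (X →L[𝕜] X)ˣ, (V : X →L[𝕜] X) = ((1 - c : ℝ) : 𝕜) • 1 + (c : 𝕜) • L ∧
      ‖((V⁻¹ : (X →L[𝕜] X)ˣ) : X →L[𝕜] X)‖ ≤ 2 / (1 - c) := by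
  have h1c : 0 < 1 - c := by linarith
  have hne : ((1 - c : ℝ) : 𝕜) ≠ 0 := by exact_mod_cast h1c.ne'
  have hnc : ‖((1 - c : ℝ) : 𝕜)‖ = 1 - c := by rw [RCLike.norm_ofReal, abs_of_pos h1c]
  have hcc : ‖(c : 𝕜)‖ = c := by rw [RCLike.norm_ofReal, abs_of_pos hc0]
  set t : X →L[𝕜] X := (-(c : 𝕜) / ((1 - c : ℝ) : 𝕜)) • L with ht
  have htn : ‖t‖ ≤ 1 / 2 := by
    rw [ht, norm_smul, norm_div, norm_neg, hnc, hcc, div_mul_eq_mul_div, div_le_iff₀ h1c]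
    nlinarith [mul_le_mul_of_nonneg_left hL hc0.le]
  have hu : IsUnit (((1 - c : ℝ) : 𝕜) • (1 : X →L[𝕜] X) + (c : 𝕜) • L) := by
    have h := (Units.mk0 _ hne • Units.oneSub t (by linarith)).isUnit
    convert h using 1
    rw [Units.val_smul, Units.smul_def, Units.val_mk0, Units.val_oneSub, smul_sub, ht, smul_smul,
      mul_div_cancel₀ _ hne, neg_smul, sub_neg_eq_add]
  obtain ⟨V, hV⟩ := hu
  refine ⟨V, hV, ?_⟩
  -- An a priori bound: taking norms gives `(1 - c)‖V⁻¹‖ ≤ 1 + cC‖V⁻¹‖`, and `cC ≤ (1 - c)/2`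
  -- absorbs the last term.
  have key : ((1 - c : ℝ) : 𝕜) • (↑V⁻¹ : X →L[𝕜] X) = 1 - (c : 𝕜) • (L * ↑V⁻¹) := by
    have := V.mul_inv
    rw [hV, add_mul, smul_mul_assoc, one_mul, smul_mul_assoc] at this
    rw [← this, add_sub_cancel_right]
  have h2 : (1 - c) * ‖(↑V⁻¹ : X →L[𝕜] X)‖ ≤ 1 + c * (C * ‖(↑V⁻¹ : X →L[𝕜] X)‖) := by
    have := congrArg norm key
    rw [norm_smul, hnc] at this
    rw [this]
    refine (norm_sub_le _ _).trans (add_le_add ContinuousLinearMap.norm_id_le ?_)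
    rw [norm_smul, hcc]
    gcongr
    exact (norm_mul_le _ _).trans (by gcongr)
  rw [le_div_iff₀ h1c]
  nlinarith [mul_le_mul_of_nonneg_right hcC (norm_nonneg (↑V⁻¹ : X →L[𝕜] X))]

/-- One step of the factorization: replacing part of the scalar `r` of the invertible operator
`r + L q` by `L e`, for `e` far out in the approximate unit, keeps the operator invertible and
hardly moves the preimage of `x`. -/
theorem exists_perturbation_isUnit {l : Filter A} [l.NeBot] {L : A →L[𝕜] X →L[𝕜] X} {K c r : ℝ}
    (hK : ∀ᶠ e in l, ‖e‖ ≤ K) (hc0 : 0 < c) (hc1 : c < 1) (hcC : c * (‖L‖ * K) ≤ (1 - c) / 2)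
    (hL : ∀ q, Tendsto (fun e => L e * L q) l (𝓝 (L q)))
    {x : X} (hx : Tendsto (fun e => L e x) l (𝓝 x)) (q : A)
    (hq : IsUnit ((r : 𝕜) • (1 : X →L[𝕜] X) + L q)) {ε : ℝ} (hε : 0 < ε) :
    ∃ e : A, ‖e‖ ≤ K ∧
      IsUnit (((r * (1 - c) : ℝ) : 𝕜) • (1 : X →L[𝕜] X) + L (q + ((r * c : ℝ) : 𝕜) • e)) ∧
      dist (Ring.inverse ((r : 𝕜) • (1 : X →L[𝕜] X) + L q) x)
        (Ring.inverse (((r * (1 - c) : ℝ) : 𝕜) • (1 : X →L[𝕜] X)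
          + L (q + ((r * c : ℝ) : 𝕜) • e)) x) < ε := by
  -- For `‖e‖ > K` the unit is the junk value `1`, so that `V` becomes a total function of `e`.
  have hV : ∀ e : A, ∃ V : (X →L[𝕜] X)ˣ, ‖e‖ ≤ K →
      (V : X →L[𝕜] X) = ((1 - c : ℝ) : 𝕜) • 1 + (c : 𝕜) • L e ∧
      ‖((V⁻¹ : (X →L[𝕜] X)ˣ) : X →L[𝕜] X)‖ ≤ 2 / (1 - c) := by
    intro e
    by_cases he : ‖e‖ ≤ K
    · obtain ⟨V, hV⟩ := exists_inverse_convexCombination_one hc0 hc1 hcC (L e)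
        ((L.le_opNorm e).trans (by gcongr))
      exact ⟨V, fun _ => hV⟩
    · exact ⟨1, fun h => absurd h he⟩
  choose V hV using hV
  have hbdd : ∀ᶠ e in l, ‖(↑(V e)⁻¹ : X →L[𝕜] X)‖ ≤ 2 / (1 - c) :=
    hK.mono fun e he => (hV e he).2
  have hnc : ‖(c : 𝕜)‖ = c := by rw [RCLike.norm_ofReal, abs_of_pos hc0]
  have hdiff : ∀ e, ‖e‖ ≤ K → (1 : X →L[𝕜] X) - V e = (c : 𝕜) • (1 - L e) := by
    intro e he
    rw [(hV e he).1]
    push_cast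
    module
  -- With the uniform bound on `V⁻¹`, this turns convergence of `L e` to the identity, on `L q` and
  -- at `x`, into the same convergence for `(V e)⁻¹`.
  have hinv : ∀ e, ‖e‖ ≤ K →
      (↑(V e)⁻¹ : X →L[𝕜] X) - 1 = (c : 𝕜) • (↑(V e)⁻¹ * (1 - L e)) := by
    intro e he
    rw [← mul_smul_comm, ← hdiff e he, mul_sub, mul_one, Units.inv_mul]
  have h1 : Tendsto (fun e => (↑(V e)⁻¹ : X →L[𝕜] X) * L q) l (𝓝 (L q)) := by
    rw [tendsto_iff_norm_sub_tendsto_zero]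
    have h0 : Tendsto (fun e => c * (2 / (1 - c) * ‖L e * L q - L q‖)) l (𝓝 0) := by
      simpa using ((tendsto_iff_norm_sub_tendsto_zero.1 (hL q)).const_mul (2 / (1 - c))).const_mul c
    refine squeeze_zero' (Eventually.of_forall fun _ => norm_nonneg _) ?_ h0
    filter_upwards [hK, hbdd] with e he hb
    have : (↑(V e)⁻¹ : X →L[𝕜] X) * L q - L q = (c : 𝕜) • (↑(V e)⁻¹ * (L q - L e * L q)) := by
      have := congrArg (· * L q) (hinv e he)
      simpa only [sub_mul, one_mul, smul_mul_assoc, mul_assoc] using this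
    rw [this, norm_smul, hnc, norm_sub_rev (L e * L q)]
    gcongr
    exact (norm_mul_le _ _).trans (by gcongr)
  have h2 : Tendsto (fun e => (↑(V e)⁻¹ : X →L[𝕜] X) x) l (𝓝 x) := by
    rw [tendsto_iff_norm_sub_tendsto_zero]
    have h0 : Tendsto (fun e => c * (2 / (1 - c) * ‖L e x - x‖)) l (𝓝 0) := by
      simpa using ((tendsto_iff_norm_sub_tendsto_zero.1 hx).const_mul (2 / (1 - c))).const_mul c
    refine squeeze_zero' (Eventually.of_forall fun _ => norm_nonneg _) ?_ h0
    filter_upwards [hK, hbdd] with e he hb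
    have : (↑(V e)⁻¹ : X →L[𝕜] X) x - x = (c : 𝕜) • (↑(V e)⁻¹ : X →L[𝕜] X) (x - L e x) :=
      DFunLike.congr_fun (hinv e he) x
    rw [this, norm_smul, hnc, norm_sub_rev (L e x)]
    gcongr
    exact (ContinuousLinearMap.le_opNorm _ _).trans (by gcongr)
  have hW : Tendsto (fun e => (r : 𝕜) • (1 : X →L[𝕜] X) + ↑(V e)⁻¹ * L q) l
      (𝓝 ((r : 𝕜) • (1 : X →L[𝕜] X) + L q)) := tendsto_const_nhds.add h1
  have hWu : ∀ᶠ e in l, IsUnit ((r : 𝕜) • (1 : X →L[𝕜] X) + ↑(V e)⁻¹ * L q) :=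
    hW.eventually (Units.isOpen.mem_nhds hq)
  have hWi : Tendsto (fun e => Ring.inverse ((r : 𝕜) • (1 : X →L[𝕜] X) + ↑(V e)⁻¹ * L q)) l
      (𝓝 (Ring.inverse ((r : 𝕜) • (1 : X →L[𝕜] X) + L q))) := by
    obtain ⟨u, hu⟩ := hq
    rw [← hu] at hW ⊢
    exact (NormedRing.inverse_continuousAt u).tendsto.comp hW
  have hlim : Tendsto (fun e => Ring.inverse ((r : 𝕜) • (1 : X →L[𝕜] X) + ↑(V e)⁻¹ * L q)
      ((↑(V e)⁻¹ : X →L[𝕜] X) x)) l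
      (𝓝 (Ring.inverse ((r : 𝕜) • (1 : X →L[𝕜] X) + L q) x)) := tendsto_clm_apply hWi h2
  obtain ⟨e, he, hu, hd⟩ := (hK.and (hWu.and (hlim.eventually (Metric.ball_mem_nhds _ hε)))).exists
  -- The new operator need not be close to the old one, but it is the unit `V e` times an operator
  -- that is; its inverse at `x` is therefore close to the old one.
  have hfac : ((r * (1 - c) : ℝ) : 𝕜) • (1 : X →L[𝕜] X) + L (q + ((r * c : ℝ) : 𝕜) • e)
      = V e * ((r : 𝕜) • (1 : X →L[𝕜] X) + ↑(V e)⁻¹ * L q) := by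
    rw [mul_add, Units.mul_inv_cancel_left, mul_smul_comm, mul_one, (hV e he).1, map_add, map_smul]
    push_cast
    module
  refine ⟨e, he, ?_, ?_⟩
  · rw [hfac]
    exact (V e).isUnit.mul hu
  · rw [hfac, Ring.inverse_mul (Or.inl (V e).isUnit), Ring.inverse_unit, dist_comm]
    exact hd

/-- **Cohen's factorization theorem**, for a bounded family of operators `L e` that acts as an
approximate unit on the operators `L q` and at the vector `x`. -/
theorem exists_cohen_factorization [CompleteSpace A] {l : Filter A} [l.NeBot]
    (L : A →L[𝕜] X →L[𝕜] X) {K : ℝ} (hK : ∀ᶠ e in l, ‖e‖ ≤ K)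
    (hL : ∀ q, Tendsto (fun e => L e * L q) l (𝓝 (L q)))
    {x : X} (hx : Tendsto (fun e => L e x) l (𝓝 x)) : ∃ (a : A) (y : X), x = L a y := by
  have hK0 : 0 ≤ K := by
    obtain ⟨e, he⟩ := hK.exists
    exact (norm_nonneg e).trans he
  have hC : 0 ≤ ‖L‖ * K := by positivity
  obtain ⟨c, hc0, hc1, hcC⟩ : ∃ c : ℝ, 0 < c ∧ c < 1 ∧ c * (‖L‖ * K) ≤ (1 - c) / 2 := by
    -- With `C = ‖L‖ * K` the condition reads `c(2C + 1) ≤ 1`; the `2` in the denominator keeps `c <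
    -- 1` even when `C = 0`.
    refine ⟨1 / (2 * (‖L‖ * K) + 2), by positivity, ?_, ?_⟩
    · rw [div_lt_one (by positivity)]; linarith
    · field_simp
      linarith
  let F : ℕ → A → (X →L[𝕜] X) := fun n q => (((1 - c) ^ n : ℝ) : 𝕜) • 1 + L q
  have hstep : ∀ (n : ℕ) (q : {q : A // IsUnit (F n q)}), ∃ q' : {q : A // IsUnit (F (n + 1) q)},
      dist (q : A) q' ≤ (c * K) * (1 - c) ^ n ∧
      dist (Ring.inverse (F n q) x) (Ring.inverse (F (n + 1) q') x) ≤ 1 * (1 / 2) ^ n := by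
    intro n q
    obtain ⟨e, he, hu, hd⟩ := exists_perturbation_isUnit hK hc0 hc1 hcC hL hx q.1 q.2
      (ε := 1 * (1 / 2) ^ n) (by positivity)
    refine ⟨⟨_, hu⟩, ?_, hd.le⟩
    have h1c : 0 ≤ 1 - c := by linarith
    rw [dist_self_add_right, norm_smul, RCLike.norm_ofReal, abs_of_nonneg (by positivity)]
    calc (1 - c) ^ n * c * ‖e‖ ≤ (1 - c) ^ n * c * K := by gcongr
      _ = _ := by ring
  choose next hnext₁ hnext₂ using hstep
  -- Starting from `q₀ = 0`, where `F 0 0 = 1`, the scalar part decays like `(1 - c) ^ n`, while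
  -- `qₙ` and the preimages of `x` form Cauchy sequences.
  let q : (n : ℕ) → {q : A // IsUnit (F n q)} :=
    Nat.rec ⟨0, by simp [F]⟩ fun n q => next n q
  have hq : CauchySeq fun n => (q n).1 :=
    cauchySeq_of_le_geometric (f := fun n => (q n).1)
      (1 - c) (c * K) (by linarith) fun n => hnext₁ n (q n)
  have hy : CauchySeq fun n => Ring.inverse (F n (q n).1) x :=
    cauchySeq_of_le_geometric (f := fun n => Ring.inverse (F n (q n).1) x)
      (1 / 2) 1 (by norm_num) fun n => hnext₂ n (q n)
  obtain ⟨a, ha⟩ := cauchySeq_tendsto_of_complete hq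
  obtain ⟨y, hy⟩ := cauchySeq_tendsto_of_complete hy
  refine ⟨a, y, ?_⟩
  have hF : Tendsto (fun n => F n (q n).1) atTop (𝓝 (L a)) := by
    have h0 : Tendsto (fun n : ℕ => (((1 - c) ^ n : ℝ) : 𝕜)) atTop (𝓝 ((0 : ℝ) : 𝕜)) :=
      (RCLike.continuous_ofReal.tendsto 0).comp
        (tendsto_pow_atTop_nhds_zero_of_lt_one (by linarith) (by linarith))
    have h := (h0.smul_const (1 : X →L[𝕜] X)).add ((L.continuous.tendsto a).comp ha)
    rwa [RCLike.ofReal_zero, zero_smul, zero_add] at h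
  refine tendsto_nhds_unique (f := fun _ : ℕ => x) tendsto_const_nhds
    ((tendsto_clm_apply hF hy).congr fun n => ?_)
  rw [← mul_apply_eq_comp, Ring.mul_inverse_cancel _ (q n).2,
    one_apply_eq_self]

end CohenFactorization

/-! ### Weak-* limits in the bidual -/

section WeakStarLimit

variable {𝕜 A X : Type*} [RCLike 𝕜] [NormedAddCommGroup A] [NormedSpace 𝕜 A]
  [NormedAddCommGroup X] [NormedSpace 𝕜 X]

variable (𝕜) in
/-- A bounded ultrafilter on a normed space converges in the weak-* topology of the bidual. -/
theorem exists_bidual_limit {U : Ultrafilter A} {K : ℝ} (hK : ∀ᶠ e in (U : Filter A), ‖e‖ ≤ K) :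
    ∃ Λ : StrongDual 𝕜 (StrongDual 𝕜 A),
      ∀ g : StrongDual 𝕜 A, Tendsto (fun e => g e) U (𝓝 (Λ g)) := by
  -- Banach–Alaoglu: the canonical image of the ultrafilter contains a weak-* compact ball, so it
  -- converges.
  let j : A → WeakDual 𝕜 (StrongDual 𝕜 A) := fun e =>
    StrongDual.toWeakDual (NormedSpace.inclusionInDoubleDual 𝕜 A e)
  have hmem : U.map j ≤ 𝓟 (WeakDual.toStrongDual ⁻¹'
      Metric.closedBall (0 : StrongDual 𝕜 (StrongDual 𝕜 A)) K) := by
    rw [le_principal_iff, Ultrafilter.coe_map, mem_map]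
    filter_upwards [hK] with e he
    refine (mem_closedBall_zero_iff (E := StrongDual 𝕜 (StrongDual 𝕜 A))).2 ?_
    exact (NormedSpace.double_dual_bound 𝕜 A e).trans he
  obtain ⟨Λ, -, hΛ⟩ := (WeakDual.isCompact_closedBall 0 K).ultrafilter_le_nhds _ hmem
  refine ⟨WeakDual.toStrongDual Λ, fun g => ?_⟩
  exact ((WeakDual.eval_continuous g).tendsto Λ).comp
    (show Tendsto j U (𝓝 Λ) from hΛ)

/-- Evaluation of a dual-space-valued operator at an element of the bidual:
`⟨x, bidualSlice Λ G⟩ = ⟨G(·) x, Λ⟩`. -/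
noncomputable def bidualSlice (Λ : StrongDual 𝕜 (StrongDual 𝕜 A)) :
    (A →L[𝕜] StrongDual 𝕜 X) →L[𝕜] StrongDual 𝕜 X :=
  ContinuousLinearMap.compL 𝕜 X (StrongDual 𝕜 A) 𝕜 Λ ∘L
    (ContinuousLinearMap.flipₗᵢ 𝕜 A X 𝕜 : (A →L[𝕜] X →L[𝕜] 𝕜) →L[𝕜] X →L[𝕜] A →L[𝕜] 𝕜)

theorem tendsto_bidualSlice {Λ : StrongDual 𝕜 (StrongDual 𝕜 A)} {U : Filter A}
    (hΛ : ∀ g : StrongDual 𝕜 A, Tendsto (fun e => g e) U (𝓝 (Λ g)))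
    (G : A →L[𝕜] StrongDual 𝕜 X) (x : X) :
    Tendsto (fun e => G e x) U (𝓝 (bidualSlice Λ G x)) :=
  hΛ (G.flip x)

end WeakStarLimit

/-- A two-sided approximate unit `U` that converges to `Λ` in the weak-* topology of the bidual. -/
structure IsMixedUnit {𝕜 A : Type*} [RCLike 𝕜] [NonUnitalNormedRing A] [NormedSpace 𝕜 A]
    (Λ : StrongDual 𝕜 (StrongDual 𝕜 A)) (U : Filter A) : Prop where
  isApproximateUnit : U.IsApproximateUnit
  tendsto : ∀ g : StrongDual 𝕜 A, Tendsto (fun e => g e) U (𝓝 (Λ g))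

/-! ### The limit operators on the dual -/

namespace IsMixedUnit

variable {𝕜 A X : Type*} [RCLike 𝕜] [NonUnitalNormedRing A] [NormedSpace 𝕜 A]
  [NormedAddCommGroup X] [NormedSpace 𝕜 X] {Λ : StrongDual 𝕜 (StrongDual 𝕜 A)} {U : Filter A}

variable {M : BanachBimodule 𝕜 A X}

variable (Λ M) in
/-- The weak-* limit of `φ · e` along an approximate unit. -/
noncomputable def rightLimit : StrongDual 𝕜 X →L[𝕜] StrongDual 𝕜 X :=
  bidualSlice Λ ∘L M.dual.ract.flip

variable (Λ M) in
/-- The weak-* limit of `e · φ` along an approximate unit. -/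
noncomputable def leftLimit : StrongDual 𝕜 X →L[𝕜] StrongDual 𝕜 X :=
  bidualSlice Λ ∘L M.dual.lact.flip

theorem tendsto_rightLimit (h : IsMixedUnit Λ U) (φ : StrongDual 𝕜 X) (x : X) :
    Tendsto (fun e => φ (M.lact e x)) U (𝓝 (rightLimit Λ M φ x)) :=
  tendsto_bidualSlice h.tendsto (M.dual.ract.flip φ) x

theorem tendsto_leftLimit (h : IsMixedUnit Λ U) (φ : StrongDual 𝕜 X) (x : X) :
    Tendsto (fun e => φ (M.ract e x)) U (𝓝 (leftLimit Λ M φ x)) :=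
  tendsto_bidualSlice h.tendsto (M.dual.lact.flip φ) x

theorem rightLimit_eq (h : IsMixedUnit Λ U) {φ : StrongDual 𝕜 X} {x : X} {c : 𝕜}
    (hc : Tendsto (fun e => φ (M.lact e x)) U (𝓝 c)) : rightLimit Λ M φ x = c :=
  have := h.isApproximateUnit.neBot
  tendsto_nhds_unique (h.tendsto_rightLimit φ x) hc

theorem leftLimit_eq (h : IsMixedUnit Λ U) {φ : StrongDual 𝕜 X} {x : X} {c : 𝕜}
    (hc : Tendsto (fun e => φ (M.ract e x)) U (𝓝 c)) : leftLimit Λ M φ x = c :=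
  have := h.isApproximateUnit.neBot
  tendsto_nhds_unique (h.tendsto_leftLimit φ x) hc

theorem rightLimit_lact (h : IsMixedUnit Λ U) (φ : StrongDual 𝕜 X) (a : A) (x : X) :
    rightLimit Λ M φ (M.lact a x) = φ (M.lact a x) := by
  refine h.rightLimit_eq ?_
  have hc : Continuous fun b => φ (M.lact b x) := by fun_prop
  simpa only [Function.comp_def, M.lact_mul] using
    (hc.tendsto a).comp (h.isApproximateUnit.tendsto_mul_right a)

theorem leftLimit_ract (h : IsMixedUnit Λ U) (φ : StrongDual 𝕜 X) (a : A) (x : X) :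
    leftLimit Λ M φ (M.ract a x) = φ (M.ract a x) := by
  refine h.leftLimit_eq ?_
  have hc : Continuous fun b => φ (M.ract b x) := by fun_prop
  simpa only [Function.comp_def, M.ract_mul] using
    (hc.tendsto a).comp (h.isApproximateUnit.tendsto_mul_left a)

/-- For left products, the two actions on `X` commute, so the limit passes through. For right
products both sides equal `φ · a`: one uses `e * a → a`, the other `a * e → a`, so the approximate
unit must be two-sided. -/
theorem isBimoduleHom_rightLimit (h : IsMixedUnit Λ U) :
    BanachBimodule.IsBimoduleHom M.dual M.dual (rightLimit Λ M) where
  map_lact a φ := by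
    ext x
    refine h.rightLimit_eq ?_
    simpa only [BanachBimodule.dual_lact_apply, M.lact_ract] using
      h.tendsto_rightLimit (M := M) φ (M.ract a x)
  map_ract a φ := by
    ext x
    rw [BanachBimodule.dual_ract_apply, h.rightLimit_lact]
    refine h.rightLimit_eq ?_
    have hc : Continuous fun b => φ (M.lact b x) := by fun_prop
    simpa only [Function.comp_def, M.lact_mul, BanachBimodule.dual_ract_apply] using
      (hc.tendsto a).comp (h.isApproximateUnit.tendsto_mul_left a)

theorem isBimoduleHom_leftLimit (h : IsMixedUnit Λ U) :
    BanachBimodule.IsBimoduleHom M.dual M.dual (leftLimit Λ M) where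
  map_lact a φ := by
    ext x
    rw [BanachBimodule.dual_lact_apply, h.leftLimit_ract]
    refine h.leftLimit_eq ?_
    have hc : Continuous fun b => φ (M.ract b x) := by fun_prop
    simpa only [Function.comp_def, M.ract_mul, BanachBimodule.dual_lact_apply] using
      (hc.tendsto a).comp (h.isApproximateUnit.tendsto_mul_right a)
  map_ract a φ := by
    ext x
    refine h.leftLimit_eq ?_
    simpa only [BanachBimodule.dual_ract_apply, M.lact_ract] using
      h.tendsto_leftLimit (M := M) φ (M.lact a x)

theorem rightLimit_leftLimit_eq_zero (h : IsMixedUnit Λ U) {φ : StrongDual 𝕜 X}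
    (hφ : ∀ y ∈ M.productSet, φ y = 0) : rightLimit Λ M (leftLimit Λ M φ) = 0 := by
  ext x
  refine h.rightLimit_eq (tendsto_const_nhds.congr fun e => ?_)
  exact (h.leftLimit_eq (tendsto_const_nhds.congr fun f => (hφ _ ⟨e, f, x, rfl⟩).symm)).symm

theorem rightLimit_leftLimit_apply (h : IsMixedUnit Λ U) (φ : StrongDual 𝕜 X) {y : X}
    (hy : y ∈ M.productSet) : rightLimit Λ M (leftLimit Λ M φ) y = φ y := by
  obtain ⟨a, b, x, rfl⟩ := hy
  rw [← M.lact_ract, h.rightLimit_lact, M.lact_ract, h.leftLimit_ract]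

end IsMixedUnit

/-- Refining to an ultrafilter preserves the bound and the approximate-unit property, and forces
weak-* convergence. -/
theorem HasBoundedApproximateIdentity.exists_isMixedUnit (𝕜 : Type*) {A : Type*} [RCLike 𝕜]
    [NonUnitalNormedRing A] [NormedSpace 𝕜 A] (hA : HasBoundedApproximateIdentity A) :
    ∃ (Λ : StrongDual 𝕜 (StrongDual 𝕜 A)) (U : Filter A), IsMixedUnit Λ U ∧
      ∃ K : ℝ, ∀ᶠ e in U, ‖e‖ ≤ K := by
  obtain ⟨l, hl, K, hK⟩ := hA
  have := hl.neBot
  obtain ⟨Λ, hΛ⟩ := exists_bidual_limit 𝕜 (U := Ultrafilter.of l) (hK.filter_mono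
    (Ultrafilter.of_le l))
  refine ⟨Λ, Ultrafilter.of l, ⟨{ tendsto_mul_left := fun m => ?_, tendsto_mul_right := fun m => ?_ }, hΛ⟩, K,
    hK.filter_mono (Ultrafilter.of_le l)⟩
  · exact (hl.tendsto_mul_left m).mono_left (Ultrafilter.of_le l)
  · exact (hl.tendsto_mul_right m).mono_left (Ultrafilter.of_le l)


/-! ### Contractions of tuples extended by one entry -/

section FinTuple

variable {A : Type*} {n : ℕ}

theorem Fin.tail_snoc_eq_snoc_tail (v : Fin (n + 1) → A) (e : A) :
    Fin.tail (Fin.snoc v e : Fin (n + 2) → A) = Fin.snoc (Fin.tail v) e := by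
  ext i
  refine Fin.lastCases ?_ (fun i => ?_) i
  · rw [Fin.tail, Fin.succ_last]
    exact (Fin.snoc_last (α := fun _ => A) e v).trans (Fin.snoc_last (α := fun _ => A) e _).symm
  · rw [Fin.snoc_castSucc (α := fun _ => A), Fin.tail, Fin.succ_castSucc,
      Fin.snoc_castSucc (α := fun _ => A), Fin.tail]

theorem Fin.init_cons_eq_cons_init (v : Fin (n + 1) → A) (e : A) :
    Fin.init (Fin.cons e v : Fin (n + 2) → A) = Fin.cons e (Fin.init v) := by
  ext i
  refine Fin.cases ?_ (fun i => ?_) i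
  · rfl
  · rw [Fin.cons_succ, Fin.init, ← Fin.succ_castSucc, Fin.cons_succ, Fin.init]

variable [Mul A]

theorem Fin.contractNth_castSucc_snoc (k : Fin n) (v : Fin (n + 1) → A) (e : A) :
    k.castSucc.castSucc.contractNth (· * ·) (Fin.snoc v e : Fin (n + 2) → A) =
      Fin.snoc (k.castSucc.contractNth (· * ·) v) e := by
  ext i
  refine Fin.lastCases ?_ (fun i => ?_) i
  · have h : ¬ n < k := by omega
    have h' : n ≠ k := by omega
    simp [Fin.contractNth, h, h']
  · simp only [Fin.contractNth, Fin.succ_castSucc, Fin.snoc_castSucc (α := fun _ => A),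
      Fin.val_castSucc]

theorem Fin.contractNth_last_snoc (v : Fin (n + 1) → A) (e : A) :
    (Fin.last n).castSucc.contractNth (· * ·) (Fin.snoc v e : Fin (n + 2) → A) =
      Fin.snoc (Fin.init v) (v (Fin.last n) * e) := by
  ext i
  refine Fin.lastCases ?_ (fun i => ?_) i
  · simp [Fin.contractNth]
  · simp [Fin.contractNth, Fin.init]

theorem Fin.contractNth_succ_cons (k : Fin n) (v : Fin (n + 1) → A) (e : A) :
    k.succ.castSucc.contractNth (· * ·) (Fin.cons e v : Fin (n + 2) → A) =
      Fin.cons e (k.castSucc.contractNth (· * ·) v) := by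
  ext i
  refine Fin.cases ?_ (fun i => ?_) i
  · simp [Fin.contractNth]
  · simp [Fin.contractNth]

theorem Fin.contractNth_zero_cons (v : Fin (n + 1) → A) (e : A) :
    (0 : Fin (n + 1)).castSucc.contractNth (· * ·) (Fin.cons e v : Fin (n + 2) → A) =
      Fin.cons (e * v 0) (Fin.tail v) := by
  ext i
  refine Fin.cases ?_ (fun i => ?_) i
  · simp [Fin.contractNth]
  · simp [Fin.contractNth, Fin.tail]

end FinTuple

/-! ### Cocycles with one-sided trivial values -/

namespace IsMixedUnit

open BanachBimodule

variable {𝕜 A X : Type*} [RCLike 𝕜] [NonUnitalNormedRing A] [NormedSpace 𝕜 A]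
  [IsScalarTower 𝕜 A A] [SMulCommClass 𝕜 A A]
  [NormedAddCommGroup X] [NormedSpace 𝕜 X] {Λ : StrongDual 𝕜 (StrongDual 𝕜 A)} {U : Filter A}
  {M : BanachBimodule 𝕜 A X}

/-- A cocycle whose values have trivial right products is a coboundary. -/
theorem mem_coboundaries_of_ract_eq_zero (h : IsMixedUnit Λ U) {m : ℕ}
    {T : A [×(m + 1)]→L[𝕜] StrongDual 𝕜 X} (hT : T ∈ M.dual.cocycles (m + 1))
    (h0 : ∀ a v, M.dual.ract a (T v) = 0) : T ∈ M.dual.coboundaries (m + 1) := by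
  have := h.isApproximateUnit.neBot
  let S : A [×m]→L[𝕜] StrongDual 𝕜 X :=
    (bidualSlice Λ).compContinuousMultilinearMap T.curryRight
  have hS : ∀ v x, Tendsto (fun e => T (Fin.snoc v e) x) U (𝓝 (S v x)) := fun v x =>
    tendsto_bidualSlice h.tendsto (T.curryRight v) x
  -- `S(v) = lim T(v, e)`. In the cocycle identity at `(v, e)` the last contraction has sign `(-1) ^
  -- (m + 1)` and tends to `T v`, so `δS = (-1) ^ m T`.
  refine ⟨(-1 : 𝕜) ^ m • S, ?_⟩
  rw [map_smul]
  ext v x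
  have hδ : ∀ e, T (Fin.snoc (Fin.tail v) e) (M.ract (v 0) x)
      + ∑ k : Fin m, (-1 : 𝕜) ^ ((k : ℕ) + 1) *
          T (Fin.snoc (k.castSucc.contractNth (· * ·) v) e) x
      = (-1 : 𝕜) ^ m * T (Fin.snoc (Fin.init v) (v (Fin.last m) * e)) x := by
    intro e
    have := DFunLike.congr_fun (DFunLike.congr_fun (LinearMap.mem_ker.1 hT) (Fin.snoc v e)) x
    rw [coboundary_apply, h0, smul_zero, add_zero, Fin.sum_univ_castSucc] at this
    simp only [Fin.tail_snoc_eq_snoc_tail, Fin.contractNth_castSucc_snoc,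
      Fin.contractNth_last_snoc, Fin.val_castSucc, Fin.val_last,
      Fin.snoc_apply_zero, add_apply, sum_apply, smul_apply, zero_apply, smul_eq_mul,
      dual_lact_apply] at this
    linear_combination this
  have hlim := tendsto_nhds_unique
    (((hS (Fin.tail v) (M.ract (v 0) x)).add (tendsto_finsetSum Finset.univ fun (k : Fin m) _ =>
      (hS (k.castSucc.contractNth (· * ·) v) x).const_mul ((-1 : 𝕜) ^ ((k : ℕ) + 1)))).congr hδ)
    (b := (-1 : 𝕜) ^ m * T v x) (by
      have hc : Continuous fun b => (-1 : 𝕜) ^ m * T.curryRight (Fin.init v) b x := by fun_prop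
      have := (hc.tendsto (v (Fin.last m))).comp
        (h.isApproximateUnit.tendsto_mul_left (v (Fin.last m)))
      simpa only [Function.comp_def, ContinuousMultilinearMap.curryRight_apply, Fin.snoc_init_self] using this)
  -- The outer right product in `δS` has no counterpart in the limit identity; it vanishes because
  -- right products of values of `T` do.
  have hS0 : S (Fin.init v) (M.lact (v (Fin.last m)) x) = 0 :=
    tendsto_nhds_unique (hS _ _) (tendsto_const_nhds.congr fun e =>
      (DFunLike.congr_fun (h0 (v (Fin.last m)) (Fin.snoc (Fin.init v) e)) x).symm)
  have hsq : (-1 : 𝕜) ^ m * (-1) ^ m = 1 := by rw [← mul_pow]; simp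
  simp only [coboundary_apply, add_apply, sum_apply, smul_apply, smul_eq_mul, dual_lact_apply,
    dual_ract_apply, hS0]
  linear_combination (-1 : 𝕜) ^ m * hlim + T v x * hsq

/-- A cocycle whose values have trivial left products is a coboundary. -/
theorem mem_coboundaries_of_lact_eq_zero (h : IsMixedUnit Λ U) {m : ℕ}
    {T : A [×(m + 1)]→L[𝕜] StrongDual 𝕜 X} (hT : T ∈ M.dual.cocycles (m + 1))
    (h0 : ∀ a v, M.dual.lact a (T v) = 0) : T ∈ M.dual.coboundaries (m + 1) := by
  have := h.isApproximateUnit.neBot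
  let S : A [×m]→L[𝕜] StrongDual 𝕜 X :=
    (bidualSlice Λ).compContinuousMultilinearMap T.curryLeft.flipMultilinear
  have hS : ∀ v x, Tendsto (fun e => T (Fin.cons e v) x) U (𝓝 (S v x)) := fun v x =>
    tendsto_bidualSlice h.tendsto (T.curryLeft.flipMultilinear v) x
  -- Here `S(v) = lim T(e, v)`. Prepending `e` shifts every contraction of `v` by one place and
  -- flips its sign, and the first contraction `-T(e * v 0, …)` tends to `-T v`; thus `δS = -T`.
  refine ⟨-S, ?_⟩
  rw [map_neg]
  ext v x
  have hδ : ∀ e, (∑ k : Fin m, (-1 : 𝕜) ^ ((k : ℕ) + 1) *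
        T (Fin.cons e (k.castSucc.contractNth (· * ·) v)) x)
      + (-1 : 𝕜) ^ (m + 1) * T (Fin.cons e (Fin.init v)) (M.lact (v (Fin.last m)) x)
      = - T (Fin.cons (e * v 0) (Fin.tail v)) x := by
    intro e
    have := DFunLike.congr_fun (DFunLike.congr_fun (LinearMap.mem_ker.1 hT) (Fin.cons e v)) x
    rw [coboundary_apply, h0, zero_add, Fin.sum_univ_succ] at this
    simp only [Fin.init_cons_eq_cons_init, Fin.contractNth_succ_cons, Fin.contractNth_zero_cons,
      Fin.val_zero, Fin.val_succ, ← Fin.succ_last, Fin.cons_succ, add_apply, sum_apply,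
      smul_apply, zero_apply, smul_eq_mul, dual_ract_apply,
      pow_succ _ (_ + 1), mul_neg_one, neg_mul, Finset.sum_neg_distrib] at this
    linear_combination -this
  have hlim := tendsto_nhds_unique
    (((tendsto_finsetSum Finset.univ fun (k : Fin m) _ =>
      (hS (k.castSucc.contractNth (· * ·) v) x).const_mul ((-1 : 𝕜) ^ ((k : ℕ) + 1))).add
      ((hS (Fin.init v) (M.lact (v (Fin.last m)) x)).const_mul ((-1 : 𝕜) ^ (m + 1)))).congr hδ)
    (b := - T v x) (by
      have hc : Continuous fun b => - T.curryLeft b (Fin.tail v) x := by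
        refine Continuous.neg ?_
        exact (T.curryLeft.flipMultilinear (Fin.tail v)).flip x |>.continuous
      have := (hc.tendsto (v 0)).comp (h.isApproximateUnit.tendsto_mul_right (v 0))
      simpa only [Function.comp_def, ContinuousMultilinearMap.curryLeft_apply, Fin.cons_self_tail] using this)
  have hS0 : S (Fin.tail v) (M.ract (v 0) x) = 0 :=
    tendsto_nhds_unique (hS _ _) (tendsto_const_nhds.congr fun e =>
      (DFunLike.congr_fun (h0 (v 0) (Fin.cons e (Fin.tail v))) x).symm)
  simp only [coboundary_apply, add_apply, sum_apply, smul_apply, neg_apply, smul_eq_mul,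
    dual_lact_apply, dual_ract_apply, hS0]
  linear_combination -hlim

end IsMixedUnit

theorem BanachBimodule.ApproxCohomology.map_mk {𝕜 A X Y : Type*} [RCLike 𝕜]
    [NonUnitalNormedRing A] [NormedSpace 𝕜 A] [IsScalarTower 𝕜 A A] [SMulCommClass 𝕜 A A]
    [NormedAddCommGroup X] [NormedSpace 𝕜 X] [NormedAddCommGroup Y] [NormedSpace 𝕜 Y]
    {M : BanachBimodule 𝕜 A X} {N : BanachBimodule 𝕜 A Y} {f : X →L[𝕜] Y}
    (hf : IsBimoduleHom M N f) (n : ℕ) (T : M.cocycles n) :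
    ApproxCohomology.map hf n (Submodule.Quotient.mk T) =
      Submodule.Quotient.mk ⟨cochainMap A f n T, hf.cochainMap_mem_cocycles n T T.2⟩ := rfl

namespace IsMixedUnit

open BanachBimodule

/-! ### Splitting the restriction map -/

section RestrictDual

variable {𝕜 A X : Type*} [RCLike 𝕜] [NonUnitalNormedRing A] [NormedSpace 𝕜 A]
  [NormedAddCommGroup X] [NormedSpace 𝕜 X] {Λ : StrongDual 𝕜 (StrongDual 𝕜 A)} {U : Filter A}
  {M : BanachBimodule 𝕜 A X}

/-- This makes `P ∘ R` of an extension independent of the extension chosen. -/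
theorem rightLimit_leftLimit_congr (h : IsMixedUnit Λ U) {φ ψ : StrongDual 𝕜 X}
    (hφ : ∀ y ∈ M.productSet, φ y = ψ y) :
    rightLimit Λ M (leftLimit Λ M φ) = rightLimit Λ M (leftLimit Λ M ψ) := by
  rw [← sub_eq_zero, ← map_sub, ← map_sub]
  exact h.rightLimit_leftLimit_eq_zero fun y hy => by
    rw [sub_apply, hφ y hy, sub_self]

/-- The restriction map `X* → X₁*`, with `X₁ = A · X · A`, has a bounded right inverse that is a
bimodule homomorphism. -/
theorem exists_section_restrictDual (h : IsMixedUnit Λ U) (X₁ : M.SubBimodule)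
    (hX₁ : (X₁.toSubmodule : Set X) = M.productSet) :
    ∃ s : StrongDual 𝕜 X₁.toSubmodule →L[𝕜] StrongDual 𝕜 X,
      IsBimoduleHom X₁.toBanachBimodule.dual M.dual s ∧
      (∀ ψ, restrictDual X₁.toSubmodule (s ψ) = ψ) ∧
      ∀ φ, s (restrictDual X₁.toSubmodule φ) = rightLimit Λ M (leftLimit Λ M φ) := by
  -- Hahn–Banach extensions are chosen with no linearity. Applying `P ∘ R` removes the dependence on
  -- the choice, so `s` is linear and equivariant; norm preservation makes it bounded.
  choose ext hext hnorm using fun ψ : StrongDual 𝕜 X₁.toSubmodule =>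
    exists_extension_norm_eq X₁.toSubmodule ψ
  have hmem : ∀ {y}, y ∈ M.productSet → y ∈ X₁.toSubmodule := fun {y} hy => by
    rwa [← hX₁] at hy
  have hmem' : ∀ {y}, y ∈ X₁.toSubmodule → y ∈ M.productSet := fun {y} hy => by
    rwa [← hX₁]
  let s : StrongDual 𝕜 X₁.toSubmodule →L[𝕜] StrongDual 𝕜 X := LinearMap.mkContinuous
    { toFun := fun ψ => rightLimit Λ M (leftLimit Λ M (ext ψ))
      map_add' := fun ψ χ => by
        rw [← map_add, ← map_add]
        refine h.rightLimit_leftLimit_congr fun y hy => ?_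
        have hy' := hmem hy
        rw [add_apply, hext _ ⟨y, hy'⟩, hext _ ⟨y, hy'⟩, hext _ ⟨y, hy'⟩, add_apply]
      map_smul' := fun c ψ => by
        rw [RingHom.id_apply, ← map_smul, ← map_smul]
        refine h.rightLimit_leftLimit_congr fun y hy => ?_
        have hy' := hmem hy
        rw [smul_apply, hext _ ⟨y, hy'⟩, hext _ ⟨y, hy'⟩, smul_apply] }
    ‖rightLimit Λ M ∘L leftLimit Λ M‖
    fun ψ => by
      rw [← hnorm ψ]
      exact (rightLimit Λ M ∘L leftLimit Λ M).le_opNorm (ext ψ)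
  have hs : ∀ ψ, s ψ = rightLimit Λ M (leftLimit Λ M (ext ψ)) := fun ψ => rfl
  refine ⟨s, ⟨fun a ψ => ?_, fun a ψ => ?_⟩, fun ψ => ?_, fun φ => ?_⟩
  · rw [hs, hs, ← h.isBimoduleHom_rightLimit.map_lact, ← h.isBimoduleHom_leftLimit.map_lact]
    refine h.rightLimit_leftLimit_congr fun y hy => ?_
    rw [hext _ ⟨y, hmem hy⟩, dual_lact_apply, dual_lact_apply]
    exact (hext ψ _).symm
  · rw [hs, hs, ← h.isBimoduleHom_rightLimit.map_ract, ← h.isBimoduleHom_leftLimit.map_ract]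
    refine h.rightLimit_leftLimit_congr fun y hy => ?_
    rw [hext _ ⟨y, hmem hy⟩, dual_ract_apply, dual_ract_apply]
    exact (hext ψ _).symm
  · ext y
    rw [restrictDual_apply, hs, h.rightLimit_leftLimit_apply _ (hmem' y.2), hext]
  · rw [hs]
    refine h.rightLimit_leftLimit_congr fun y hy => ?_
    rw [hext _ ⟨y, hmem hy⟩, restrictDual_apply]

theorem closedComplemented_annihilator (h : IsMixedUnit Λ U) (X₁ : Submodule 𝕜 X)
    (hX₁ : (X₁ : Set X) = M.productSet) : (annihilator X₁).ClosedComplemented := by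
  refine ⟨(ContinuousLinearMap.id 𝕜 _ - rightLimit Λ M ∘L leftLimit Λ M).codRestrict _
    fun φ y hy => ?_, fun φ => Subtype.ext ?_⟩
  · have : rightLimit Λ M (leftLimit Λ M φ.1) = 0 :=
      h.rightLimit_leftLimit_eq_zero fun y hy => φ.2 y (by rwa [← hX₁] at hy)
    change φ.1 - rightLimit Λ M (leftLimit Λ M φ.1) = φ.1
    rw [this, sub_zero]
  · have hy' : y ∈ M.productSet := by rwa [← hX₁]
    simp [h.rightLimit_leftLimit_apply φ hy']

end RestrictDual

/-! ### The isomorphism in cohomology -/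

section Cohomology

variable {𝕜 A X : Type*} [RCLike 𝕜] [NonUnitalNormedRing A] [NormedSpace 𝕜 A]
  [IsScalarTower 𝕜 A A] [SMulCommClass 𝕜 A A]
  [NormedAddCommGroup X] [NormedSpace 𝕜 X] {Λ : StrongDual 𝕜 (StrongDual 𝕜 A)} {U : Filter A}
  {M : BanachBimodule 𝕜 A X}

/-- A cocycle `T` with values in `X*` is cohomologous to the weak-* limit of `e · T · f`. -/
theorem sub_cochainMap_mem_coboundaries (h : IsMixedUnit Λ U) {m : ℕ}
    {T : A [×(m + 1)]→L[𝕜] StrongDual 𝕜 X} (hT : T ∈ M.dual.cocycles (m + 1)) :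
    T - cochainMap A (rightLimit Λ M ∘L leftLimit Λ M) (m + 1) T ∈
      M.dual.coboundaries (m + 1) := by
  have hP := h.isBimoduleHom_rightLimit (M := M)
  have hR := h.isBimoduleHom_leftLimit (M := M)
  have h₁ : T - cochainMap A (rightLimit Λ M) (m + 1) T ∈ M.dual.coboundaries (m + 1) := by
    refine h.mem_coboundaries_of_ract_eq_zero
      (sub_mem hT (hP.cochainMap_mem_cocycles _ T hT)) fun a v => ?_
    ext x
    rw [dual_ract_apply, sub_apply, sub_apply, cochainMap_apply, h.rightLimit_lact, sub_self,
      zero_apply]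
  have h₂ : T - cochainMap A (leftLimit Λ M) (m + 1) T ∈ M.dual.coboundaries (m + 1) := by
    refine h.mem_coboundaries_of_lact_eq_zero
      (sub_mem hT (hR.cochainMap_mem_cocycles _ T hT)) fun a v => ?_
    ext x
    rw [dual_lact_apply, sub_apply, sub_apply, cochainMap_apply, h.leftLimit_ract, sub_self,
      zero_apply]
  -- `T - PRT = (T - PT) + P(T - RT)`, and composition with the homomorphism `P` preserves
  -- coboundaries.
  have h₃ := add_mem h₁ (hP.cochainMap_mem_coboundaries _ _ h₂)
  convert h₃ using 1
  ext v x
  simp [cochainMap_apply]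

/-- Surjectivity comes from `r ∘ s = 1`. For injectivity, if `rT` lies in the strong closure, so
does `s(rT) = ET`, which differs from `T` by a coboundary. -/
theorem bijective_approxCohomology_map (h : IsMixedUnit Λ U) (X₁ : M.SubBimodule)
    (hX₁ : (X₁.toSubmodule : Set X) = M.productSet) {n : ℕ} (hn : 1 ≤ n) :
    Function.Bijective (ApproxCohomology.map X₁.isBimoduleHom_restrictDual n) := by
  obtain ⟨m, rfl⟩ := Nat.exists_eq_add_of_le' hn
  obtain ⟨s, hs, hrs, hsr⟩ := h.exists_section_restrictDual X₁ hX₁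
  constructor
  · rw [injective_iff_map_eq_zero]
    intro z hz
    obtain ⟨⟨T, hT⟩, rfl⟩ := Submodule.Quotient.mk_surjective _ z
    rw [ApproxCohomology.map_mk, Submodule.Quotient.mk_eq_zero] at hz
    rw [Submodule.Quotient.mk_eq_zero]
    change T ∈ strongClosure (M.dual.coboundaries (m + 1))
    have h₁ := hs.cochainMap_mem_strongClosure _ _ hz
    have h₂ : cochainMap A s (m + 1) (cochainMap A (restrictDual X₁.toSubmodule) (m + 1) T)
        = cochainMap A (rightLimit Λ M ∘L leftLimit Λ M) (m + 1) T := by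
      ext1 v
      exact hsr (T v)
    have h₃ : T - cochainMap A (rightLimit Λ M ∘L leftLimit Λ M) (m + 1) T ∈
        strongClosure (M.dual.coboundaries (m + 1)) :=
      @subset_closure _ (strongTopology _ _ _ _) _ _ (h.sub_cochainMap_mem_coboundaries hT)
    have h₄ := add_mem h₃ (h₂ ▸ h₁)
    rwa [sub_add_cancel] at h₄
  · intro z
    obtain ⟨⟨T, hT⟩, rfl⟩ := Submodule.Quotient.mk_surjective _ z
    refine ⟨Submodule.Quotient.mk ⟨cochainMap A s (m + 1) T, hs.cochainMap_mem_cocycles _ T hT⟩, ?_⟩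
    rw [ApproxCohomology.map_mk]
    congr 1
    ext1
    ext1 v
    exact hrs (T v)

end Cohomology

end IsMixedUnit

/-! ### The essential part and the product set -/

namespace BanachBimodule

variable {𝕜 A X : Type*} [RCLike 𝕜] [NonUnitalNormedRing A] [NormedSpace 𝕜 A]
  [NormedAddCommGroup X] [NormedSpace 𝕜 X]

/-- The points at which a bounded family of operators converges to the identity form a closed
set. -/
theorem isClosed_setOf_tendsto_self {l : Filter A} {K : ℝ} (hK : ∀ᶠ e in l, ‖e‖ ≤ K)
    (f : A →L[𝕜] X →L[𝕜] X) : IsClosed {x : X | Tendsto (fun e => f e x) l (𝓝 x)} := by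
  rw [← closure_subset_iff_isClosed]
  intro x hx
  rw [Set.mem_ofPred_eq, Metric.tendsto_nhds]
  intro ε hε
  -- The summand `1` accounts for the distance from `y` back to `x` and keeps `C` positive; the
  -- absolute value is needed since `l` may be trivial and `K` negative.
  set C : ℝ := ‖f‖ * |K| + 1 with hC
  have hCpos : 0 < C := by positivity
  obtain ⟨y, hy, hxy⟩ := Metric.mem_closure_iff.1 hx (ε / (2 * C)) (by positivity)
  filter_upwards [hK, Metric.tendsto_nhds.1 hy (ε / 2) (by positivity)] with e he hey
  have h1 : dist (f e x) (f e y) ≤ ‖f‖ * |K| * dist x y := by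
    rw [dist_eq_norm, ← map_sub, dist_eq_norm]
    refine (f.le_opNorm₂ e (x - y)).trans ?_
    gcongr
    exact he.trans (le_abs_self K)
  have h2 : C * dist x y < ε / 2 := by
    calc C * dist x y < C * (ε / (2 * C)) := by gcongr
      _ = ε / 2 := by field_simp
  have h3 := dist_triangle4 (f e x) (f e y) y x
  rw [dist_comm y x] at h3
  rw [hC] at h2
  linarith

/-- The essential part `{x : e · x → x and x · e → x}` of a bimodule along an approximate unit. -/
def essentialPart (M : BanachBimodule 𝕜 A X) {l : Filter A} (hl : l.IsApproximateUnit) :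
    M.SubBimodule where
  carrier := {x | Tendsto (fun e => M.lact e x) l (𝓝 x) ∧ Tendsto (fun e => M.ract e x) l (𝓝 x)}
  add_mem' {x y} hx hy := by
    simp only [Set.mem_ofPred_eq, map_add]
    exact ⟨hx.1.add hy.1, hx.2.add hy.2⟩
  zero_mem' := by simp [tendsto_const_nhds]
  smul_mem' c x hx := by
    simp only [Set.mem_ofPred_eq, map_smul]
    exact ⟨hx.1.const_smul c, hx.2.const_smul c⟩
  lact_mem a x hx := by
    refine ⟨?_, ?_⟩
    · have hc : Continuous fun b => M.lact b x := by fun_prop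
      simpa only [Function.comp_def, M.lact_mul] using
        (hc.tendsto a).comp (hl.tendsto_mul_right a)
    · simpa only [Function.comp_def, M.lact_ract] using
        ((M.lact a).continuous.tendsto x).comp hx.2
  ract_mem a x hx := by
    refine ⟨?_, ?_⟩
    · simpa only [Function.comp_def, M.lact_ract] using
        ((M.ract a).continuous.tendsto x).comp hx.1
    · have hc : Continuous fun b => M.ract b x := by fun_prop
      simpa only [Function.comp_def, M.ract_mul] using
        (hc.tendsto a).comp (hl.tendsto_mul_left a)

theorem mem_essentialPart {M : BanachBimodule 𝕜 A X} {l : Filter A} {hl : l.IsApproximateUnit}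
    {x : X} : x ∈ (M.essentialPart hl).toSubmodule ↔
      Tendsto (fun e => M.lact e x) l (𝓝 x) ∧ Tendsto (fun e => M.ract e x) l (𝓝 x) := Iff.rfl

theorem isClosed_essentialPart (M : BanachBimodule 𝕜 A X) {l : Filter A}
    (hl : l.IsApproximateUnit) {K : ℝ} (hK : ∀ᶠ e in l, ‖e‖ ≤ K) :
    IsClosed ((M.essentialPart hl).toSubmodule : Set X) :=
  (isClosed_setOf_tendsto_self hK M.lact).inter (isClosed_setOf_tendsto_self hK M.ract)

theorem productSet_subset_essentialPart (M : BanachBimodule 𝕜 A X) {l : Filter A}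
    (hl : l.IsApproximateUnit) : M.productSet ⊆ (M.essentialPart hl).toSubmodule := by
  rintro _ ⟨a, b, x, rfl⟩
  refine ⟨?_, ?_⟩
  · have hc : Continuous fun c => M.lact c (M.ract b x) := by fun_prop
    simpa only [Function.comp_def, M.lact_mul, M.lact_ract] using
      (hc.tendsto a).comp (hl.tendsto_mul_right a)
  · have hc : Continuous fun c => M.ract c (M.lact a x) := by fun_prop
    simpa only [Function.comp_def, M.ract_mul] using (hc.tendsto b).comp (hl.tendsto_mul_left b)

/-- Cohen factorization is applied twice, first `x = z · b` and then `z = a · y`. Although the right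
action reverses products, the operator form of the theorem only needs `L e * L q → L q`, which here
follows from `q * e → q`. -/
theorem isNeoUnital_of_tendsto [CompleteSpace A] [CompleteSpace X] (M : BanachBimodule 𝕜 A X)
    {l : Filter A} (hl : l.IsApproximateUnit) {K : ℝ} (hK : ∀ᶠ e in l, ‖e‖ ≤ K)
    (hleft : ∀ x, Tendsto (fun e => M.lact e x) l (𝓝 x))
    (hright : ∀ x, Tendsto (fun e => M.ract e x) l (𝓝 x)) : M.IsNeoUnital := by
  have := hl.neBot
  intro x
  obtain ⟨b, z, hz⟩ := exists_cohen_factorization M.ract hK (fun q => by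
    have : ∀ e, M.ract e * M.ract q = M.ract (q * e) := fun e => by
      ext y; exact (M.ract_mul q e y).symm
    simp only [this]
    exact (M.ract.continuous.tendsto q).comp (hl.tendsto_mul_left q)) (hright x)
  obtain ⟨a, y, hy⟩ := exists_cohen_factorization M.lact hK (fun q => by
    have : ∀ e, M.lact e * M.lact q = M.lact (e * q) := fun e => by
      ext y; exact (M.lact_mul e q y).symm
    simp only [this]
    exact (M.lact.continuous.tendsto q).comp (hl.tendsto_mul_right q)) (hleft z)
  exact ⟨a, b, y, hy ▸ hz⟩

/-- Factoring inside the essential part, complete because it is closed, keeps the middle factor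
there. -/
theorem isNeoUnital_essentialPart [CompleteSpace A] [CompleteSpace X] (M : BanachBimodule 𝕜 A X)
    {l : Filter A} (hl : l.IsApproximateUnit) {K : ℝ} (hK : ∀ᶠ e in l, ‖e‖ ≤ K) :
    (M.essentialPart hl).toBanachBimodule.IsNeoUnital := by
  have := (M.isClosed_essentialPart hl hK).completeSpace_coe
  refine isNeoUnital_of_tendsto _ hl hK (fun x => ?_) (fun x => ?_)
  · exact tendsto_subtype_rng.2 (mem_essentialPart.1 x.2).1
  · exact tendsto_subtype_rng.2 (mem_essentialPart.1 x.2).2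

/-- This is why the product set, not evidently closed under addition, is a closed subspace. -/
theorem coe_essentialPart [CompleteSpace A] [CompleteSpace X] (M : BanachBimodule 𝕜 A X)
    {l : Filter A} (hl : l.IsApproximateUnit) {K : ℝ} (hK : ∀ᶠ e in l, ‖e‖ ≤ K) :
    ((M.essentialPart hl).toSubmodule : Set X) = M.productSet := by
  refine subset_antisymm (fun x hx => ?_) (M.productSet_subset_essentialPart hl)
  obtain ⟨a, b, y, h⟩ := M.isNeoUnital_essentialPart hl hK ⟨x, hx⟩
  exact ⟨a, b, y, congrArg Subtype.val h⟩

end BanachBimodule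

theorem mainTheorem5 {𝕜 A X : Type*} [RCLike 𝕜]
    [NonUnitalNormedRing A] [NormedSpace 𝕜 A] [IsScalarTower 𝕜 A A] [SMulCommClass 𝕜 A A]
    [CompleteSpace A] (hA : HasBoundedApproximateIdentity A)
    [NormedAddCommGroup X] [NormedSpace 𝕜 X] [CompleteSpace X] (M : BanachBimodule 𝕜 A X) :
    ∃ X₁ : M.SubBimodule,
      (X₁.toSubmodule : Set X) = M.productSet ∧
      IsClosed (X₁.toSubmodule : Set X) ∧
      X₁.toBanachBimodule.IsNeoUnital ∧
      (BanachBimodule.annihilator X₁.toSubmodule).ClosedComplemented ∧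
      ∀ n : ℕ, 1 ≤ n →
        ∃ e : M.dual.ApproxCohomology n ≃ₗ[𝕜] X₁.toBanachBimodule.dual.ApproxCohomology n,
          (e : M.dual.ApproxCohomology n →ₗ[𝕜] X₁.toBanachBimodule.dual.ApproxCohomology n) =
            BanachBimodule.ApproxCohomology.map X₁.isBimoduleHom_restrictDual n := by
  obtain ⟨Λ, U, h, K, hK⟩ := hA.exists_isMixedUnit 𝕜
  have hX₁ := M.coe_essentialPart h.isApproximateUnit hK
  refine ⟨M.essentialPart h.isApproximateUnit, hX₁, M.isClosed_essentialPart _ hK,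
    M.isNeoUnital_essentialPart _ hK, h.closedComplemented_annihilator _ hX₁, fun n hn => ?_⟩
  exact ⟨LinearEquiv.ofBijective _ (h.bijective_approxCohomology_map _ hX₁ hn), rfl⟩
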